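/- Let $n\ge 1$ be an integer, let $\mathbb B_n=\{z\in\mathbb C^n:|z|<1\}$ and $\mathbb S_n=\{z\in\mathbb C^n:|z|=1\}$, let $\langle z,\omega\rangle=\sum_{i=1}^n z_i\overline{\omega_i}$, and let $\nu$ be Lebesgue measure on $\mathbb B_n$ normalized so that $\nu(\mathbb B_n)=1$. For $p>0$, a positive Borel measure $\mu$ on $\mathbb B_n$ is called a $p$-Carleson measure if $$\|\mu\|_{\mathcal{CM}_p}=\sup_{\zeta\in\mathbb S_n,\ r>0}\left(\frac{\mu(Q_r(\zeta))}{r^{np}}\right)^{1/2}<\infty,\qquad Q_r(\zeta)=\{z\in\mathbb B_n:|1-\langle z,\zeta\rangle|<r\}.$$ Theorem (general invariance of modified Carleson measures). Suppose $p,\eta\in\left(0,\frac{n+1}{n}\right)$, $a>\max\left\{-\frac{1+\eta}{2},\,-\frac{1+\eta+n(1-p)}{2}\right\}$ and $b>\frac{1+\eta}{2}$. Let $f:\mathbb B_n\to\mathbb C$ be Lebesgue measurable and suppose that $|f(z)|^2(1-|z|^2)^{\eta}\,d\nu(z)$ is a $p$-Carleson measure. Then the integral $$T_{a,b}f(z)=\int_{\mathbb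 B_n}\frac{(1-|\omega|^2)^{b-1}}{|1-\langle z,\omega\rangle|^{n+a+b}}\,f(\omega)\,d\nu(\omega)$$ converges absolutely for every $z\in\mathbb B_n$, and $|T_{a,b}f(z)|^2(1-|z|^2)^{2a+\eta}\,d\nu(z)$ is also a $p$-Carleson measure. -/

import Mathlib

noncomputable section

namespace ModifiedCarleson

open MeasureTheory
open scoped ENNReal

/-- The open unit ball of `ℂⁿ` (with the Euclidean norm). -/
def unitBall (n : ℕ) : Set (EuclideanSpace ℂ (Fin n)) := Metric.ball 0 1

/-- The unit sphere of `ℂⁿ`. -/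
def unitSphere (n : ℕ) : Set (EuclideanSpace ℂ (Fin n)) := Metric.sphere 0 1

/-- The Hermitian product `⟨z, w⟩ = ∑ i, z i * conj (w i)`, linear in the first variable. -/
def herm {n : ℕ} (z w : EuclideanSpace ℂ (Fin n)) : ℂ :=
  ∑ i, z i * (starRingEnd ℂ) (w i)

/-- `herm` is Mathlib's inner product with the two variables exchanged. -/
theorem herm_eq_inner {n : ℕ} (z w : EuclideanSpace ℂ (Fin n)) :
    herm z w = inner ℂ w z := by
  simp [herm, PiLp.inner_apply, RCLike.inner_apply]

/-- Lebesgue measure on the unit ball, normalized to have total mass one. -/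
def ballMeasure (n : ℕ) : Measure (EuclideanSpace ℂ (Fin n)) :=
  (volume (unitBall n))⁻¹ • volume.restrict (unitBall n)

/-- The normalization is a genuine one. -/
instance instIsProbabilityMeasureBallMeasure (n : ℕ) :
    IsProbabilityMeasure (ballMeasure n) := by
  constructor
  have h0 : volume (unitBall n) ≠ 0 := (Metric.measure_ball_pos volume 0 one_pos).ne'
  have h1 : volume (unitBall n) ≠ ⊤ := measure_ball_lt_top.ne
  simp [ballMeasure, ENNReal.inv_mul_cancel h0 h1]

/-- The Carleson tube `Q_r(ζ) = {z ∈ 𝔹ₙ : |1 - ⟨z, ζ⟩| < r}`. -/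
def carlesonTube {n : ℕ} (ζ : EuclideanSpace ℂ (Fin n)) (r : ℝ) :
    Set (EuclideanSpace ℂ (Fin n)) :=
  {z | z ∈ unitBall n ∧ ‖1 - herm z ζ‖ < r}

/-- The `p`-Carleson norm `sup (μ(Q_r(ζ)) / r^(np))^(1/2)`, the supremum being over all
tubes, `ζ` on the sphere and `r > 0`; its value may be `∞`. -/
def carlesonNorm {n : ℕ} (p : ℝ) (μ : Measure (EuclideanSpace ℂ (Fin n))) : ℝ≥0∞ :=
  ⨆ ζ ∈ unitSphere n, ⨆ r : ℝ, ⨆ _ : 0 < r,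
    (μ (carlesonTube ζ r) / ENNReal.ofReal (r ^ ((n : ℝ) * p))) ^ (1 / 2 : ℝ)

/-- `μ` is a `p`-Carleson measure. -/
def IsCarlesonMeasure {n : ℕ} (p : ℝ) (μ : Measure (EuclideanSpace ℂ (Fin n))) : Prop :=
  carlesonNorm p μ < ⊤

/-- The measure `|g(z)|² (1 - |z|²)^c dν(z)` on the unit ball. -/
def weightedMeasure {n : ℕ} (g : EuclideanSpace ℂ (Fin n) → ℂ) (c : ℝ) :
    Measure (EuclideanSpace ℂ (Fin n)) :=
  (ballMeasure n).withDensity fun z => ENNReal.ofReal (‖g z‖ ^ 2 * (1 - ‖z‖ ^ 2) ^ c)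

/-- The kernel `(1 - |w|²)^(b-1) / |1 - ⟨z, w⟩|^(n+a+b)`. -/
def kernelT {n : ℕ} (a b : ℝ) (z w : EuclideanSpace ℂ (Fin n)) : ℝ :=
  (1 - ‖w‖ ^ 2) ^ (b - 1) / ‖1 - herm z w‖ ^ ((n : ℝ) + a + b)

/-- The integral operator `T_{a,b} f(z) = ∫ (1 - |w|²)^(b-1) / |1 - ⟨z, w⟩|^(n+a+b) f(w) dν(w)`. -/
def opT {n : ℕ} (a b : ℝ) (f : EuclideanSpace ℂ (Fin n) → ℂ)
    (z : EuclideanSpace ℂ (Fin n)) : ℂ :=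
  ∫ w, (kernelT a b z w : ℂ) * f w ∂(ballMeasure n)

end ModifiedCarleson

end

noncomputable section

namespace ModifiedCarleson

open MeasureTheory
open scoped ENNReal

variable {n : ℕ}

local notation "𝔼" n => EuclideanSpace ℂ (Fin n)

/-! The proof is a weighted Schur test. Write D = |1 - ⟨z, w⟩| and dμ = |f|² (1 - |w|²)^η dν.
Cauchy–Schwarz bounds |T f(z)|² by the product of ∫ (1 - |w|²)^t D^(-u) dν(w) and ∫ (1 -
|w|²)^(2b-2-t-η) D^(u-2(n+a+b)) dμ(w). With u = n + 1 + t + c, the Forelli–Rudin estimate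
`exists_lintegral_kernel_le` bounds the first factor by a multiple of (1 - |z|²)^(-c).

Multiply by (1 - |z|²)^(2a+η), integrate over Q_r(x) and apply Tonelli. By
`exists_lintegral_kernel_tube_le` the inner z-integral is O(2^(-ks)) for w at quasi-distance about
2^k r from x, where s = n + 1 + 2a + η - c. Since μ(Q_{2^k r}) = O((2^k r)^(np)), the sum over k is
geometric and O(r^(np)) once np < s (`lintegral_dyadic_le`). The hypotheses on a and b are what
allow c > 0 and t > -1 to be chosen.

Both kernel estimates rest on the weighted volume bound `exists_lintegral_carlesonTube_le` and on
the quasi-metric behaviour of |1 - ⟨z, w⟩|. -/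

/-! ### The quasi-distance |1 - ⟨z, w⟩| and Carleson tubes. -/

theorem herm_sub_left (x y z : 𝔼 n) : herm (x - y) z = herm x z - herm y z := by
  simp [herm_eq_inner]

theorem herm_sub_right (x y z : 𝔼 n) : herm x (y - z) = herm x y - herm x z := by
  simp [herm_eq_inner]

theorem herm_self (z : 𝔼 n) : herm z z = ((‖z‖ ^ 2 : ℝ) : ℂ) := by
  rw [herm_eq_inner, inner_self_eq_norm_sq_to_K]
  norm_cast

theorem herm_smul_left (r : ℝ) (z w : 𝔼 n) : herm (r • z) w = r * herm z w := by
  simp [herm, Finset.mul_sum, mul_assoc]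

theorem herm_smul_right (r : ℝ) (z w : 𝔼 n) : herm z (r • w) = r * herm z w := by
  simp [herm, Finset.mul_sum, mul_left_comm]

theorem norm_herm_le (z w : 𝔼 n) : ‖herm z w‖ ≤ ‖z‖ * ‖w‖ := by
  rw [herm_eq_inner, mul_comm]
  exact norm_inner_le_norm w z

theorem star_herm (z w : 𝔼 n) : (starRingEnd ℂ) (herm z w) = herm w z := by
  rw [herm_eq_inner, herm_eq_inner, inner_conj_symm]

/-- The nonisotropic quasi-distance `|1 - ⟨z, w⟩|` is symmetric. -/
theorem norm_one_sub_herm_comm (z w : 𝔼 n) : ‖1 - herm z w‖ = ‖1 - herm w z‖ := by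
  rw [← star_herm w z, ← RCLike.norm_conj (1 - herm w z)]
  simp

theorem continuous_herm : Continuous fun q : (𝔼 n) × (𝔼 n) => herm q.1 q.2 := by
  simp only [herm_eq_inner]
  fun_prop

theorem one_sub_norm_mul_norm_le (z w : 𝔼 n) : 1 - ‖z‖ * ‖w‖ ≤ ‖1 - herm z w‖ := by
  have h := norm_sub_norm_le (1 : ℂ) (herm z w)
  have h' := norm_herm_le z w
  rw [norm_one] at h
  linarith

theorem one_sub_norm_le (z w : 𝔼 n) (hw : ‖w‖ ≤ 1) : 1 - ‖z‖ ≤ ‖1 - herm z w‖ := by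
  have := one_sub_norm_mul_norm_le z w
  nlinarith [norm_nonneg z]

theorem one_sub_norm_sq_le (z w : 𝔼 n) (hz : ‖z‖ ≤ 1) (hw : ‖w‖ ≤ 1) :
    1 - ‖z‖ ^ 2 ≤ 2 * ‖1 - herm z w‖ := by
  have := one_sub_norm_le z w hw
  nlinarith [norm_nonneg z]

theorem norm_one_sub_herm_pos {z w : 𝔼 n} (hz : ‖z‖ < 1) (hw : ‖w‖ ≤ 1) :
    0 < ‖1 - herm z w‖ := by
  have := one_sub_norm_le z w hw
  linarith

theorem norm_one_sub_herm_le_two (z w : 𝔼 n) (hz : ‖z‖ < 1) (hw : ‖w‖ ≤ 1) :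
    ‖1 - herm z w‖ < 2 := by
  have h := norm_sub_le (1 : ℂ) (herm z w)
  have h' := norm_herm_le z w
  rw [norm_one] at h
  nlinarith [norm_nonneg z, norm_nonneg w]

theorem norm_sub_sq_le (z w : 𝔼 n) (hz : ‖z‖ ≤ 1) (hw : ‖w‖ ≤ 1) :
    ‖z - w‖ ^ 2 ≤ 2 * ‖1 - herm z w‖ := by
  have h1 : ‖z - w‖ ^ 2 = ‖z‖ ^ 2 - 2 * (herm z w).re + ‖w‖ ^ 2 := by
    rw [herm_eq_inner, @norm_sub_sq ℂ, inner_re_symm]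
    rfl
  have h2 : 1 - (herm z w).re ≤ ‖1 - herm z w‖ := by
    simpa using Complex.re_le_norm (1 - herm z w)
  nlinarith [norm_nonneg z, norm_nonneg w]

/-- Quasi-triangle inequality for `|1 - ⟨z, w⟩|` on the closed ball. -/
theorem norm_one_sub_herm_quasi_triangle (w z x : 𝔼 n)
    (hw : ‖w‖ ≤ 1) (hz : ‖z‖ ≤ 1) (hx : ‖x‖ ≤ 1) :
    ‖1 - herm w x‖ ≤ 2 * ‖1 - herm w z‖ + 4 * ‖1 - herm z x‖ := by
  -- The cross term is at most |w - z| |z - x|, which AM–GM and `norm_sub_sq_le` bound by the sum of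
  -- the two quasi-distances; 1 - |z|² costs two more copies of the second.
  have e : 1 - herm w x = (1 - herm w z) + herm (w - z) (z - x) + (1 - herm z x)
      - ((1 - ‖z‖ ^ 2 : ℝ) : ℂ) := by
    have := herm_self z
    simp only [herm_sub_left, herm_sub_right, this]
    push_cast
    ring
  have h1 := norm_sub_sq_le w z hw hz
  have h2 := norm_sub_sq_le z x hz hx
  have h3 := norm_herm_le (w - z) (z - x)
  have h4 := one_sub_norm_sq_le z x hz hx
  have h5 : 0 ≤ 1 - ‖z‖ ^ 2 := by nlinarith [norm_nonneg z]
  rw [e]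
  refine (norm_sub_le _ _).trans ?_
  have h6 := norm_add₃_le (a := 1 - herm w z) (b := herm (w - z) (z - x)) (c := 1 - herm z x)
  rw [Complex.norm_real, Real.norm_of_nonneg h5]
  nlinarith [sq_nonneg (‖w - z‖ - ‖z - x‖)]

theorem mem_unitBall {z : 𝔼 n} : z ∈ unitBall n ↔ ‖z‖ < 1 := by simp [unitBall]

theorem mem_unitSphere {z : 𝔼 n} : z ∈ unitSphere n ↔ ‖z‖ = 1 := by simp [unitSphere]

theorem measurableSet_unitBall : MeasurableSet (unitBall n) := measurableSet_ball

theorem measurableSet_carlesonTube (x : 𝔼 n) (r : ℝ) : MeasurableSet (carlesonTube x r) := by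
  have h : Continuous fun z : 𝔼 n => ‖1 - herm z x‖ := by
    have := continuous_herm.comp (Continuous.prodMk_left x)
    exact (continuous_const.sub this).norm
  exact measurableSet_unitBall.inter (measurableSet_lt h.measurable measurable_const)

theorem carlesonTube_subset_two (x : 𝔼 n) (hx : ‖x‖ ≤ 1) (r : ℝ) :
    carlesonTube x r ⊆ carlesonTube x 2 :=
  fun z hz => ⟨hz.1, norm_one_sub_herm_le_two z x (mem_unitBall.1 hz.1) hx⟩

/-! ### Unweighted volume of tubes. -/

theorem exists_orthonormalBasis_eq (i₀ : Fin n) (x : 𝔼 n) (hx : ‖x‖ = 1) :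
    ∃ e : OrthonormalBasis (Fin n) ℂ (𝔼 n), e i₀ = x := by
  have h : Orthonormal ℂ (({i₀} : Set (Fin n)).domRestrict fun _ => x) := by
    constructor
    · intro i; simpa using hx
    · intro i j hij
      exact absurd (Subsingleton.elim i j) hij
  obtain ⟨e, he⟩ := h.exists_orthonormalBasis_extension_of_card_eq (by simp)
  exact ⟨e, he i₀ rfl⟩

/-- Uniqueness of Haar measure: the Euclidean and product volumes differ by a finite factor, whose
value is immaterial here. -/
theorem exists_volume_le_smul_pi (n : ℕ) : ∃ c : ℝ≥0∞, c ≠ ⊤ ∧ ∀ s : Set (Fin n → ℂ),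
    MeasurableSet s → volume ((WithLp.ofLp : (𝔼 n) → (Fin n → ℂ)) ⁻¹' s) = c * volume s := by
  let L : (𝔼 n) ≃L[ℝ] (Fin n → ℂ) := (PiLp.continuousLinearEquiv 2 ℝ fun _ : Fin n => ℂ)
  have hH : (Measure.map L volume).IsAddHaarMeasure :=
    L.isAddHaarMeasure_map volume
  have hE := Measure.isAddLeftInvariant_eq_smul (Measure.map L volume)
    (volume : Measure (Fin n → ℂ))
  refine ⟨(Measure.map L volume).addHaarScalarFactor (volume : Measure (Fin n → ℂ)),
    ENNReal.coe_ne_top, fun s hs => ?_⟩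
  have : volume ((WithLp.ofLp : (𝔼 n) → (Fin n → ℂ)) ⁻¹' s) = (Measure.map L volume) s := by
    rw [Measure.map_apply L.continuous.measurable hs]
    rfl
  rw [this]
  conv_lhs => rw [hE]
  rfl

theorem measurePreserving_repr (e : OrthonormalBasis (Fin n) ℂ (𝔼 n)) :
    MeasurePreserving e.repr volume volume := by
  let f : (𝔼 n) ≃ₗᵢ[ℝ] (𝔼 n) :=
    { e.repr.toLinearEquiv.restrictScalars ℝ with norm_map' := e.repr.norm_map }
  exact f.measurePreserving

/-- A Carleson tube of radius `r` has volume `O(r ^ (n + 1))`. -/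
theorem exists_volume_carlesonTube_le (hn : 1 ≤ n) : ∃ C : ℝ, 0 < C ∧
    ∀ x : 𝔼 n, ‖x‖ = 1 → ∀ r : ℝ, 0 < r →
      volume (carlesonTube x r) ≤ ENNReal.ofReal (C * r ^ (n + 1)) := by
  obtain ⟨m, rfl⟩ : ∃ m, n = m + 1 := ⟨n - 1, by omega⟩
  obtain ⟨c, hc, hvol⟩ := exists_volume_le_smul_pi (m + 1)
  -- The `+ 1` secures positivity without showing `c ≠ 0`.
  refine ⟨c.toReal * Real.pi * (2 * Real.pi) ^ m + 1, by positivity, fun x hx r hr => ?_⟩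
  obtain ⟨e, he⟩ := exists_orthonormalBasis_eq 0 x hx
  let B : Fin (m + 1) → Set ℂ := Fin.cons (Metric.ball 1 r) fun _ => Metric.ball 0 (√(2 * r))
  -- In an orthonormal basis starting with x, the first coordinate h = ⟨z, x⟩ lies in a disc of
  -- radius r about 1. The others have total square below 1 - |h|² ≤ 2(1 - |h|) < 2r.
  have hsub : carlesonTube x r ⊆ e.repr ⁻¹' (WithLp.ofLp ⁻¹' (Set.univ.pi B)) := by
    rintro z ⟨hz, hzr⟩
    rw [mem_unitBall] at hz
    have h0 : e.repr z 0 = herm z x := by rw [e.repr_apply_apply, he, herm_eq_inner]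
    have hs : ‖z‖ ^ 2 = ∑ i, ‖e.repr z i‖ ^ 2 := by
      rw [← e.repr.norm_map, EuclideanSpace.norm_sq_eq]
    rw [Fin.sum_univ_succ, h0] at hs
    intro i _
    refine Fin.cases ?_ (fun j => ?_) i
    · change e.repr z 0 ∈ Metric.ball 1 r
      rw [h0, mem_ball_iff_norm, norm_sub_rev]
      exact hzr
    · change e.repr z j.succ ∈ Metric.ball 0 (√(2 * r))
      rw [mem_ball_zero_iff]
      apply Real.lt_sqrt_of_sq_lt
      have h1 := Finset.single_le_sum (f := fun j : Fin m => ‖e.repr z j.succ‖ ^ 2)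
        (fun j _ => sq_nonneg _) (Finset.mem_univ j)
      have h2 := norm_sub_norm_le (1 : ℂ) (herm z x)
      rw [norm_one] at h2
      nlinarith [norm_nonneg z, norm_nonneg (herm z x), sq_nonneg (‖herm z x‖ - 1)]
  have hBm : MeasurableSet (Set.univ.pi B) := by
    refine MeasurableSet.univ_pi fun i => ?_
    refine Fin.cases ?_ (fun j => ?_) i
    · exact measurableSet_ball
    · exact measurableSet_ball
  have hpi : volume (Set.univ.pi B) = ENNReal.ofReal (Real.pi * (2 * Real.pi) ^ m * r ^ (m + 2)) := by
    rw [volume_pi_pi, Fin.prod_univ_succ]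
    simp only [B, Fin.cons_zero, Fin.cons_succ, Complex.volume_ball, Finset.prod_const,
      Finset.card_univ, Fintype.card_fin]
    have e1 : (NNReal.pi : ℝ≥0∞) = ENNReal.ofReal Real.pi := by
      rw [ENNReal.ofReal, Real.toNNReal_of_nonneg Real.pi_pos.le]; rfl
    rw [e1, ← ENNReal.ofReal_pow hr.le, ← ENNReal.ofReal_pow (Real.sqrt_nonneg _),
      Real.sq_sqrt (by positivity), ← ENNReal.ofReal_mul (by positivity),
      ← ENNReal.ofReal_mul (by positivity), ← ENNReal.ofReal_pow (by positivity),
      ← ENNReal.ofReal_mul (by positivity)]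
    congr 1
    ring
  calc volume (carlesonTube x r)
      ≤ volume (e.repr ⁻¹' (WithLp.ofLp ⁻¹' (Set.univ.pi B))) := measure_mono hsub
    _ = volume (WithLp.ofLp ⁻¹' (Set.univ.pi B) : Set (𝔼 (m + 1))) :=
      (measurePreserving_repr e).measure_preimage
        ((PiLp.continuous_ofLp 2 _).measurable hBm).nullMeasurableSet
    _ = c * ENNReal.ofReal (Real.pi * (2 * Real.pi) ^ m * r ^ (m + 2)) := by rw [hvol _ hBm, hpi]
    _ = ENNReal.ofReal (c.toReal * (Real.pi * (2 * Real.pi) ^ m * r ^ (m + 2))) := by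
      rw [ENNReal.ofReal_mul ENNReal.toReal_nonneg, ENNReal.ofReal_toReal hc]
    _ ≤ _ := by
      apply ENNReal.ofReal_le_ofReal
      have : 0 < r ^ (m + 2) := by positivity
      nlinarith

/-! ### Weighted volume of tubes, by averaging over dilations. -/

theorem lintegral_sub_rpow_le {t m R : ℝ} (ht : -1 < t) (hm : 1 ≤ m) (hmR : m ≤ 1 + R) :
    ∫⁻ l in Set.Ioo 1 m, ENNReal.ofReal ((m - l) ^ t) ≤
      ENNReal.ofReal (R ^ (t + 1) / (t + 1)) := by
  have hint : IntervalIntegrable (fun l => (m - l) ^ t) volume 1 m := by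
    have h := (intervalIntegral.intervalIntegrable_rpow' (a := m - 1) (b := m - m) ht).comp_sub_left m
    simpa using h
  have hset := (intervalIntegrable_iff_integrableOn_Ioo_of_le hm).1 hint
  rw [← ofReal_integral_eq_lintegral_ofReal hset]
  · apply ENNReal.ofReal_le_ofReal
    rw [← integral_Ioc_eq_integral_Ioo, ← intervalIntegral.integral_of_le hm,
      intervalIntegral.integral_comp_sub_left (fun u => u ^ t) m, integral_rpow (Or.inl ht)]
    simp only [sub_self]
    rw [Real.zero_rpow (by linarith), sub_zero]
    gcongr <;> linarith
  · filter_upwards [ae_restrict_mem measurableSet_Ioo] with l hl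
    exact Real.rpow_nonneg (by linarith [hl.2]) _

theorem lintegral_eq_mul_lintegral_comp_smul {E : Type*} [NormedAddCommGroup E] [NormedSpace ℝ E]
    [MeasurableSpace E] [BorelSpace E] [FiniteDimensional ℝ E] (μ : Measure E) [μ.IsAddHaarMeasure]
    {h : E → ℝ≥0∞} (hh : Measurable h) {r : ℝ} (hr : 0 < r) :
    ∫⁻ x, h x ∂μ = ENNReal.ofReal (r ^ Module.finrank ℝ E) * ∫⁻ x, h (r • x) ∂μ := by
  have hp : 0 < r ^ Module.finrank ℝ E := by positivity
  rw [← lintegral_map hh (measurable_const_smul r), Measure.map_addHaar_smul μ hr.ne',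
    lintegral_smul_measure, smul_eq_mul, ← mul_assoc, ← ENNReal.ofReal_mul hp.le,
    abs_of_pos (inv_pos.2 hp), mul_inv_cancel₀ hp.ne', ENNReal.ofReal_one, one_mul]

theorem measurable_indicator_carlesonTube_rpow (x : 𝔼 n) (R t : ℝ) :
    Measurable ((carlesonTube x R).indicator fun w => ENNReal.ofReal ((1 - ‖w‖) ^ t)) := by
  refine Measurable.indicator ?_ (measurableSet_carlesonTube x R)
  fun_prop

theorem smul_mem_carlesonTube {x w : 𝔼 n} {R l : ℝ} (hx : ‖x‖ = 1) (hl : 1 < l) (hlR : l < 1 + R)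
    (h : l • w ∈ carlesonTube x R) : w ∈ carlesonTube x (2 * R) ∧ l * ‖w‖ < 1 := by
  obtain ⟨h1, h2⟩ := h
  rw [mem_unitBall, norm_smul, Real.norm_of_nonneg (by linarith)] at h1
  have hw : ‖w‖ < 1 := by nlinarith [norm_nonneg w]
  refine ⟨⟨mem_unitBall.2 hw, ?_⟩, h1⟩
  have e : 1 - herm w x = (1 - herm (l • w) x) + ((l - 1 : ℝ) : ℂ) * herm w x := by
    rw [herm_smul_left]; push_cast; ring
  have h3 := norm_herm_le w x
  have h4 := norm_add_le (1 - herm (l • w) x) (((l - 1 : ℝ) : ℂ) * herm w x)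
  rw [norm_mul, Complex.norm_real, Real.norm_of_nonneg (by linarith)] at h4
  rw [e]
  nlinarith [norm_nonneg (herm w x)]

/-- Along the ray through w the singular weight becomes a one-dimensional power, integrable because
t > -1. This gains the factor R^(t+1) with no polar coordinates. -/
theorem lintegral_dilation_le {t R : ℝ} (ht : -1 < t) (ht0 : t ≤ 0) (hR0 : 0 < R) (hR : R ≤ 2)
    (x w : 𝔼 n) (hx : ‖x‖ = 1) :
    ∫⁻ l in Set.Ioo 1 (1 + R),
        (carlesonTube x R).indicator (fun w => ENNReal.ofReal ((1 - ‖w‖) ^ t)) (l • w) ≤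
      (carlesonTube x (2 * R)).indicator
        (fun _ => ENNReal.ofReal (3 ^ (-t) * (R ^ (t + 1) / (t + 1)))) w := by
  by_cases hw : w ∈ carlesonTube x (2 * R)
  · rw [Set.indicator_of_mem hw]
    have hw1 : ‖w‖ < 1 := mem_unitBall.1 hw.1
    -- m is the minimum of 1 + R and 1/|w|, stated so that w = 0 needs no separate treatment.
    obtain ⟨m, hm1, hmR, hwm, hlm⟩ : ∃ m : ℝ, 1 ≤ m ∧ m ≤ 1 + R ∧ ‖w‖ * m ≤ 1 ∧
        ∀ l, l < 1 + R → l * ‖w‖ < 1 → l < m := by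
      by_cases hc : ‖w‖ * (1 + R) ≤ 1
      · exact ⟨1 + R, by linarith, le_rfl, hc, fun l hl _ => hl⟩
      · push Not at hc
        have hw0 : 0 < ‖w‖ := by
          by_contra h0
          have : ‖w‖ = 0 := le_antisymm (not_lt.1 h0) (norm_nonneg w)
          rw [this] at hc; linarith
        refine ⟨1 / ‖w‖, ?_, ?_, ?_, fun l _ hl => ?_⟩
        · rw [le_div_iff₀ hw0]; linarith
        · rw [div_le_iff₀ hw0]; linarith
        · rw [mul_one_div_cancel hw0.ne']
        · rwa [lt_div_iff₀ hw0]
    have hpt : ∀ l ∈ Set.Ioo 1 (1 + R),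
        (carlesonTube x R).indicator (fun w => ENNReal.ofReal ((1 - ‖w‖) ^ t)) (l • w) ≤
        (Set.Ioo 1 m).indicator
          (fun l => ENNReal.ofReal (3 ^ (-t)) * ENNReal.ofReal ((m - l) ^ t)) l := by
      intro l hl
      by_cases hlw : l • w ∈ carlesonTube x R
      · obtain ⟨-, hl1⟩ := smul_mem_carlesonTube hx hl.1 hl.2 hlw
        have hlm' : l < m := hlm l hl.2 hl1
        rw [Set.indicator_of_mem hlw, Set.indicator_of_mem (show l ∈ Set.Ioo 1 m from ⟨hl.1, hlm'⟩),
          ← ENNReal.ofReal_mul (by positivity)]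
        apply ENNReal.ofReal_le_ofReal
        rw [norm_smul, Real.norm_of_nonneg (by linarith [hl.1])]
        -- From m|w| ≤ 1 follows m(1 - l|w|) ≥ m - l, and m ≤ 1 + R ≤ 3.
        have hkey : (m - l) / 3 ≤ 1 - l * ‖w‖ := by
          have h3 : m ≤ 3 := by linarith
          have : m * (1 - l * ‖w‖) ≥ m - l := by nlinarith [hl.1]
          nlinarith
        have hpos : 0 < m - l := by linarith
        calc (1 - l * ‖w‖) ^ t ≤ ((m - l) / 3) ^ t :=
              Real.rpow_le_rpow_of_nonpos (by positivity) hkey ht0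
          _ = 3 ^ (-t) * (m - l) ^ t := by
              rw [Real.div_rpow hpos.le (by norm_num), Real.rpow_neg (by norm_num)]
              field_simp
      · rw [Set.indicator_of_notMem hlw]
        exact zero_le
    calc _ ≤ ∫⁻ l in Set.Ioo 1 (1 + R), (Set.Ioo 1 m).indicator
          (fun l => ENNReal.ofReal (3 ^ (-t)) * ENNReal.ofReal ((m - l) ^ t)) l :=
          setLIntegral_mono' measurableSet_Ioo hpt
      _ ≤ ∫⁻ l, (Set.Ioo 1 m).indicator
          (fun l => ENNReal.ofReal (3 ^ (-t)) * ENNReal.ofReal ((m - l) ^ t)) l :=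
          setLIntegral_le_lintegral _ _
      _ = ENNReal.ofReal (3 ^ (-t)) * ∫⁻ l in Set.Ioo 1 m, ENNReal.ofReal ((m - l) ^ t) := by
          rw [lintegral_indicator measurableSet_Ioo, lintegral_const_mul _ (by fun_prop)]
      _ ≤ ENNReal.ofReal (3 ^ (-t)) * ENNReal.ofReal (R ^ (t + 1) / (t + 1)) := by
          gcongr
          exact lintegral_sub_rpow_le ht hm1 hmR
      _ = _ := (ENNReal.ofReal_mul (by positivity)).symm
  · rw [Set.indicator_of_notMem hw, nonpos_iff_eq_zero]
    refine (setLIntegral_congr_fun (g := fun _ => 0) measurableSet_Ioo fun l hl => ?_).trans (by simp)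
    exact Set.indicator_of_notMem (fun h => hw (smul_mem_carlesonTube hx hl.1 hl.2 h).1) _

/-- Dilating by l ∈ (1, 1 + R) changes the integral by at most a factor 3^d, as R ≤ 2. Averaging
over l and swapping the integrals replaces the weight by its ray integral, supported in a tube of
radius 2R, where the unweighted volume bound applies. -/
theorem exists_lintegral_carlesonTube_le_of_nonpos (hn : 1 ≤ n) {t : ℝ} (ht : -1 < t)
    (ht0 : t ≤ 0) : ∃ C : ℝ, 0 < C ∧ ∀ x : 𝔼 n, ‖x‖ = 1 → ∀ R : ℝ, 0 < R → R ≤ 2 →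
      ∫⁻ w in carlesonTube x R, ENNReal.ofReal ((1 - ‖w‖) ^ t) ≤
        ENNReal.ofReal (C * R ^ ((n : ℝ) + 1 + t)) := by
  obtain ⟨V, hV, hvol⟩ := exists_volume_carlesonTube_le hn
  set d := Module.finrank ℝ (𝔼 n) with hd
  refine ⟨3 ^ d * (3 ^ (-t) / (t + 1) * (V * 2 ^ (n + 1))), by
    have : 0 < t + 1 := by linarith
    positivity, fun x hx R hR hR2 => ?_⟩
  set h : (𝔼 n) → ℝ≥0∞ := (carlesonTube x R).indicator fun w => ENNReal.ofReal ((1 - ‖w‖) ^ t)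
    with hh
  have hm : Measurable h := measurable_indicator_carlesonTube_rpow x R t
  have ht1 : 0 < t + 1 := by linarith
  rw [← lintegral_indicator (measurableSet_carlesonTube x R)]
  have h1 : ∀ l ∈ Set.Ioo 1 (1 + R), ∫⁻ w, h w ≤ ENNReal.ofReal (3 ^ d) * ∫⁻ w, h (l • w) := by
    intro l hl
    have hl0 : 0 < l := by linarith [hl.1]
    rw [lintegral_eq_mul_lintegral_comp_smul volume hm hl0]
    gcongr
    linarith [hl.2]
  have hm2 : Measurable fun q : ℝ × (𝔼 n) => h (q.1 • q.2) := hm.comp (by fun_prop)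
  have h2 : ENNReal.ofReal R * ∫⁻ w, h w ≤ ENNReal.ofReal (3 ^ d) *
      (ENNReal.ofReal (3 ^ (-t) * (R ^ (t + 1) / (t + 1))) *
        ENNReal.ofReal (V * (2 * R) ^ (n + 1))) := by
    calc ENNReal.ofReal R * ∫⁻ w, h w = ∫⁻ l in Set.Ioo 1 (1 + R), ∫⁻ w, h w := by
          rw [setLIntegral_const, Real.volume_Ioo, mul_comm]; congr 2; ring
      _ ≤ ∫⁻ l in Set.Ioo 1 (1 + R), ENNReal.ofReal (3 ^ d) * ∫⁻ w, h (l • w) :=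
          setLIntegral_mono' measurableSet_Ioo h1
      _ = ENNReal.ofReal (3 ^ d) * ∫⁻ l in Set.Ioo 1 (1 + R), ∫⁻ w, h (l • w) :=
          lintegral_const_mul _ hm2.lintegral_prod_right'
      _ = ENNReal.ofReal (3 ^ d) * ∫⁻ w, ∫⁻ l in Set.Ioo 1 (1 + R), h (l • w) := by
          rw [lintegral_lintegral_swap hm2.aemeasurable]
      _ ≤ ENNReal.ofReal (3 ^ d) * ∫⁻ w, (carlesonTube x (2 * R)).indicator
            (fun _ => ENNReal.ofReal (3 ^ (-t) * (R ^ (t + 1) / (t + 1)))) w := by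
          gcongr with w
          exact lintegral_dilation_le ht ht0 hR hR2 x w hx
      _ ≤ _ := by
          rw [lintegral_indicator (measurableSet_carlesonTube x _), setLIntegral_const]
          gcongr
          exact hvol x hx _ (by positivity)
  rw [← ENNReal.ofReal_mul (by positivity), ← ENNReal.ofReal_mul (by positivity)] at h2
  have hRne : ENNReal.ofReal R ≠ 0 := by simpa using hR
  rw [mul_comm, ← ENNReal.le_div_iff_mul_le (Or.inl hRne) (Or.inl ENNReal.ofReal_ne_top),
    ← ENNReal.ofReal_div_of_pos hR] at h2
  refine h2.trans (ENNReal.ofReal_le_ofReal (le_of_eq ?_))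
  have e : R ^ ((n : ℝ) + 1 + t) = R ^ (t + 1) * R ^ n := by
    rw [← Real.rpow_natCast, ← Real.rpow_add hR]; ring_nf
  rw [e, mul_pow, pow_succ R]
  field_simp

/-- Weighted volume of Carleson tubes. -/
theorem exists_lintegral_carlesonTube_le (hn : 1 ≤ n) {t : ℝ} (ht : -1 < t) :
    ∃ C : ℝ, 0 < C ∧ ∀ x : 𝔼 n, ‖x‖ = 1 → ∀ R : ℝ, 0 < R →
      ∫⁻ w in carlesonTube x R, ENNReal.ofReal ((1 - ‖w‖ ^ 2) ^ t) ∂ballMeasure n ≤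
        ENNReal.ofReal (C * R ^ ((n : ℝ) + 1 + t)) := by
  obtain ⟨K, hK, hvol⟩ : ∃ C : ℝ, 0 < C ∧ ∀ x : 𝔼 n, ‖x‖ = 1 → ∀ R : ℝ, 0 < R → R ≤ 2 →
      ∫⁻ w in carlesonTube x R, ENNReal.ofReal ((1 - ‖w‖ ^ 2) ^ t) ≤
        ENNReal.ofReal (C * R ^ ((n : ℝ) + 1 + t)) := by
    rcases le_total t 0 with ht0 | ht0
    · obtain ⟨C, hC, h⟩ := exists_lintegral_carlesonTube_le_of_nonpos hn ht ht0
      refine ⟨C, hC, fun x hx R hR hR2 => le_trans ?_ (h x hx R hR hR2)⟩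
      refine setLIntegral_mono' (measurableSet_carlesonTube x R) fun w hw => ?_
      have hw1 := mem_unitBall.1 hw.1
      exact ENNReal.ofReal_le_ofReal (Real.rpow_le_rpow_of_nonpos (by linarith)
        (by nlinarith [norm_nonneg w]) ht0)
    · obtain ⟨V, hV, h⟩ := exists_volume_carlesonTube_le hn
      refine ⟨2 ^ t * V, by positivity, fun x hx R hR hR2 => ?_⟩
      calc ∫⁻ w in carlesonTube x R, ENNReal.ofReal ((1 - ‖w‖ ^ 2) ^ t)
          ≤ ∫⁻ w in carlesonTube x R, ENNReal.ofReal ((2 * R) ^ t) := by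
            refine setLIntegral_mono' (measurableSet_carlesonTube x R) fun w hw => ?_
            have hw1 := mem_unitBall.1 hw.1
            have h2 := one_sub_norm_sq_le w x hw1.le hx.le
            refine ENNReal.ofReal_le_ofReal (Real.rpow_le_rpow ?_ (by linarith [hw.2]) ht0)
            nlinarith [norm_nonneg w]
        _ ≤ ENNReal.ofReal ((2 * R) ^ t) * ENNReal.ofReal (V * R ^ (n + 1)) := by
            rw [setLIntegral_const]
            gcongr
            exact h x hx R hR
        _ = _ := by
            rw [← ENNReal.ofReal_mul (by positivity), Real.mul_rpow (by norm_num) hR.le,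
              show (n : ℝ) + 1 + t = t + ((n + 1 : ℕ) : ℝ) by push_cast; ring,
              Real.rpow_add hR, Real.rpow_natCast]
            congr 1; ring
  set c := (volume (unitBall n))⁻¹ with hc
  have hctop : c ≠ ⊤ := ENNReal.inv_ne_top.2 (Metric.measure_ball_pos volume 0 one_pos).ne'
  refine ⟨(c.toReal + 1) * K, by positivity, fun x hx R hR => ?_⟩
  have key : ∀ R : ℝ, 0 < R → R ≤ 2 →
      ∫⁻ w in carlesonTube x R, ENNReal.ofReal ((1 - ‖w‖ ^ 2) ^ t) ∂ballMeasure n ≤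
        ENNReal.ofReal ((c.toReal + 1) * K * R ^ ((n : ℝ) + 1 + t)) := by
    intro R hR hR2
    rw [ballMeasure, Measure.restrict_smul, lintegral_smul_measure,
      Measure.restrict_restrict (measurableSet_carlesonTube x R),
      Set.inter_eq_left.2 (fun z hz => hz.1), smul_eq_mul, ← hc, mul_assoc,
      ENNReal.ofReal_mul (by positivity)]
    gcongr
    · rw [← ENNReal.ofReal_toReal hctop]
      exact ENNReal.ofReal_le_ofReal (by simp)
    · exact hvol x hx R hR hR2
  rcases le_total R 2 with h2 | h2
  · exact key R hR h2
  -- Tubes stop growing at radius 2, while the bound increases with R because n + 1 + t > 0.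
  · refine (lintegral_mono_set (carlesonTube_subset_two x hx.le R)).trans
      ((key 2 two_pos le_rfl).trans ?_)
    have : 0 ≤ (n : ℝ) := n.cast_nonneg
    gcongr
    linarith

/-! ### Kernel integrals over the ball and over tubes. -/

theorem restrict_ballMeasure : (ballMeasure n).restrict (unitBall n) = ballMeasure n := by
  rw [ballMeasure, Measure.restrict_smul, Measure.restrict_restrict measurableSet_unitBall,
    Set.inter_self]

theorem ae_ballMeasure : ∀ᵐ w ∂ballMeasure n, ‖w‖ < 1 := by
  rw [← restrict_ballMeasure]
  filter_upwards [ae_restrict_mem measurableSet_unitBall] with w hw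
  exact mem_unitBall.1 hw

theorem tsum_ofReal_geometric {A q : ℝ} (hA : 0 ≤ A) (hq : 0 ≤ q) (hq1 : q < 1) :
    ∑' k : ℕ, ENNReal.ofReal (A * q ^ k) = ENNReal.ofReal (A * (1 - q)⁻¹) := by
  rw [← ENNReal.ofReal_tsum_of_nonneg (fun k => by positivity)
    ((summable_geometric_of_lt_one hq hq1).mul_left A), tsum_mul_left,
    tsum_geometric_of_lt_one hq hq1]

theorem exists_norm_smul_eq (hn : 1 ≤ n) (z : 𝔼 n) : ∃ x : 𝔼 n, ‖x‖ = 1 ∧ z = ‖z‖ • x := by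
  by_cases hz : z = 0
  · refine ⟨EuclideanSpace.single ⟨0, hn⟩ 1, by simp, by simp [hz]⟩
  · have hz' : ‖z‖ ≠ 0 := norm_ne_zero_iff.2 hz
    refine ⟨‖z‖⁻¹ • z, ?_, ?_⟩
    · rw [norm_smul, norm_inv, norm_norm, inv_mul_cancel₀ hz']
    · rw [smul_smul, mul_inv_cancel₀ hz', one_smul]

/-- Projecting z radially to x on the sphere costs only 1 - |z|, so level sets of the kernel at z
sit inside tubes centred at x. -/
theorem norm_one_sub_herm_le_of_eq_smul {z x w : 𝔼 n} (hx : ‖x‖ = 1) (hzx : z = ‖z‖ • x)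
    (hz : ‖z‖ ≤ 1) (hw : ‖w‖ ≤ 1) : ‖1 - herm w x‖ ≤ ‖1 - herm z w‖ + (1 - ‖z‖) := by
  have e : 1 - herm w x = (1 - herm w z) - ((1 - ‖z‖ : ℝ) : ℂ) * herm w x := by
    conv_rhs => rw [hzx, herm_smul_right]
    rw [norm_smul, hx, norm_norm]
    push_cast; ring
  have h3 := norm_herm_le w x
  have h4 := norm_sub_le (1 - herm w z) (((1 - ‖z‖ : ℝ) : ℂ) * herm w x)
  rw [norm_mul, Complex.norm_real, Real.norm_of_nonneg (by linarith)] at h4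
  rw [e, norm_one_sub_herm_comm z w]
  rw [hx, mul_one] at h3
  nlinarith [norm_nonneg (herm w x)]

/-- Forelli–Rudin estimate. -/
theorem exists_lintegral_kernel_le (hn : 1 ≤ n) {t c : ℝ} (ht : -1 < t) (hc : 0 < c) :
    ∃ C : ℝ, 0 < C ∧ ∀ z : 𝔼 n, ‖z‖ < 1 →
      ∫⁻ w, ENNReal.ofReal ((1 - ‖w‖ ^ 2) ^ t * ‖1 - herm z w‖ ^ (-((n : ℝ) + 1 + t + c)))
        ∂ballMeasure n ≤ ENNReal.ofReal (C * (1 - ‖z‖ ^ 2) ^ (-c)) := by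
  obtain ⟨K, hK, hvol⟩ := exists_lintegral_carlesonTube_le hn ht
  have hn0 : 0 ≤ (n : ℝ) := n.cast_nonneg
  set s : ℝ := (n : ℝ) + 1 + t with hs
  have hs0 : 0 < s := by linarith
  have hq : (2 : ℝ) ^ (-c) < 1 := Real.rpow_lt_one_of_one_lt_of_neg one_lt_two (by linarith)
  have hq' : 0 < 1 - (2 : ℝ) ^ (-c) := by linarith
  refine ⟨K * 4 ^ s * (1 - 2 ^ (-c))⁻¹ * 2 ^ c, by positivity, fun z hz => ?_⟩
  obtain ⟨x, hx, hzx⟩ := exists_norm_smul_eq hn z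
  set δ := 1 - ‖z‖ with hδ
  have hδ0 : 0 < δ := by linarith
  -- Since D ≥ δ, some k has 2^k δ ≤ D < 2^(k+1) δ. Then |1 - ⟨w, x⟩| ≤ D + δ < 4 · 2^k δ, and the
  -- summands decay like 2^(-ck).
  have hpt : ∀ᵐ w ∂ballMeasure n,
      ENNReal.ofReal ((1 - ‖w‖ ^ 2) ^ t * ‖1 - herm z w‖ ^ (-(s + c))) ≤
      ∑' k : ℕ, ENNReal.ofReal ((2 ^ k * δ) ^ (-(s + c))) *
        (carlesonTube x (4 * (2 ^ k * δ))).indicator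
          (fun w => ENNReal.ofReal ((1 - ‖w‖ ^ 2) ^ t)) w := by
    filter_upwards [ae_ballMeasure] with w hw
    have h1 : 1 ≤ ‖1 - herm z w‖ / δ := by
      rw [one_le_div₀ hδ0]; exact one_sub_norm_le z w hw.le
    obtain ⟨k, hk1, hk2⟩ := exists_nat_pow_near h1 one_lt_two
    rw [le_div_iff₀ hδ0] at hk1
    rw [div_lt_iff₀ hδ0, pow_succ] at hk2
    refine le_trans ?_ (ENNReal.le_tsum k)
    have hmem : w ∈ carlesonTube x (4 * (2 ^ k * δ)) := by
      refine ⟨mem_unitBall.2 hw, ?_⟩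
      have := norm_one_sub_herm_le_of_eq_smul hx hzx hz.le hw.le
      have h2 : (1 : ℝ) ≤ 2 ^ k := one_le_pow₀ one_le_two
      nlinarith
    rw [Set.indicator_of_mem hmem, ← ENNReal.ofReal_mul (by positivity), mul_comm]
    refine ENNReal.ofReal_le_ofReal ?_
    have : 0 ≤ (1 - ‖w‖ ^ 2) ^ t := Real.rpow_nonneg (by nlinarith [norm_nonneg w]) _
    gcongr ?_ * _
    exact Real.rpow_le_rpow_of_nonpos (by positivity) hk1 (by linarith)
  have hmeas : ∀ R : ℝ, Measurable ((carlesonTube x R).indicator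
      (fun w => ENNReal.ofReal ((1 - ‖w‖ ^ 2) ^ t))) := fun R =>
    Measurable.indicator (by fun_prop) (measurableSet_carlesonTube x R)
  calc _ ≤ ∫⁻ w, ∑' k : ℕ, ENNReal.ofReal ((2 ^ k * δ) ^ (-(s + c))) *
        (carlesonTube x (4 * (2 ^ k * δ))).indicator
          (fun w => ENNReal.ofReal ((1 - ‖w‖ ^ 2) ^ t)) w ∂ballMeasure n := lintegral_mono_ae hpt
    _ = ∑' k : ℕ, ENNReal.ofReal ((2 ^ k * δ) ^ (-(s + c))) *
        ∫⁻ w in carlesonTube x (4 * (2 ^ k * δ)), ENNReal.ofReal ((1 - ‖w‖ ^ 2) ^ t)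
          ∂ballMeasure n := by
      rw [lintegral_tsum fun k => ((hmeas _).const_mul _).aemeasurable]
      congr 1 with k
      rw [lintegral_const_mul _ (hmeas _), lintegral_indicator (measurableSet_carlesonTube x _)]
    _ ≤ ∑' k : ℕ, ENNReal.ofReal (K * 4 ^ s * δ ^ (-c) * (2 ^ (-c)) ^ k) := by
      refine ENNReal.tsum_le_tsum fun k => ?_
      refine (mul_le_mul_right (hvol x hx _ (by positivity)) _).trans (le_of_eq ?_)
      rw [← ENNReal.ofReal_mul (by positivity)]
      congr 1
      have e1 : ((2 : ℝ) ^ (-c)) ^ k = (2 ^ k) ^ (-c) := by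
        rw [← Real.rpow_natCast, ← Real.rpow_mul (by norm_num), mul_comm (-c),
          Real.rpow_mul (by norm_num), Real.rpow_natCast]
      have e2 : (2 ^ k * δ) ^ (-(s + c)) = ((2 ^ k * δ) ^ s)⁻¹ * ((2 ^ k) ^ (-c) * δ ^ (-c)) := by
        rw [← Real.mul_rpow (by positivity) hδ0.le, ← Real.rpow_neg (by positivity),
          ← Real.rpow_add (by positivity), neg_add]
      have e3 : (4 * (2 ^ k * δ)) ^ s = 4 ^ s * (2 ^ k * δ) ^ s :=
        Real.mul_rpow (by norm_num) (by positivity)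
      have : (2 ^ k * δ) ^ s ≠ 0 := by positivity
      rw [e1, e2, e3]
      field_simp
    _ = ENNReal.ofReal (K * 4 ^ s * δ ^ (-c) * (1 - 2 ^ (-c))⁻¹) :=
      tsum_ofReal_geometric (by positivity) (by positivity) hq
    _ ≤ _ := by
      refine ENNReal.ofReal_le_ofReal ?_
      have h0 : 0 < 1 - ‖z‖ ^ 2 := by nlinarith [norm_nonneg z]
      have h1 : δ ^ (-c) ≤ 2 ^ c * (1 - ‖z‖ ^ 2) ^ (-c) := by
        calc δ ^ (-c) ≤ ((1 - ‖z‖ ^ 2) / 2) ^ (-c) :=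
              Real.rpow_le_rpow_of_nonpos (by positivity) (by nlinarith [norm_nonneg z])
                (by linarith)
          _ = _ := by
              rw [Real.div_rpow h0.le (by norm_num), Real.rpow_neg (by norm_num : (0 : ℝ) ≤ 2)]
              field_simp
      calc K * 4 ^ s * δ ^ (-c) * (1 - 2 ^ (-c))⁻¹
          ≤ K * 4 ^ s * (2 ^ c * (1 - ‖z‖ ^ 2) ^ (-c)) * (1 - 2 ^ (-c))⁻¹ := by gcongr
        _ = _ := by ring

/-- The weighted integral of the kernel over a tube decays dyadically away from the tube. -/
theorem exists_lintegral_kernel_tube_le (hn : 1 ≤ n) {t c : ℝ} (ht : -1 < t) (hc : 0 < c) :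
    ∃ A : ℝ, 0 < A ∧ ∀ x : 𝔼 n, ‖x‖ = 1 → ∀ r : ℝ, 0 < r → ∀ w : 𝔼 n, ‖w‖ < 1 →
      ENNReal.ofReal ((1 - ‖w‖ ^ 2) ^ c) * ∫⁻ z in carlesonTube x r,
        ENNReal.ofReal ((1 - ‖z‖ ^ 2) ^ t * ‖1 - herm z w‖ ^ (-((n : ℝ) + 1 + t + c)))
          ∂ballMeasure n ≤
      ∑' k : ℕ, ENNReal.ofReal (A * (2 ^ (-((n : ℝ) + 1 + t))) ^ k) *
        (carlesonTube x (8 * (2 ^ k * r))).indicator 1 w := by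
  obtain ⟨K, hK, hvol⟩ := exists_lintegral_carlesonTube_le hn ht
  obtain ⟨B, hB, hker⟩ := exists_lintegral_kernel_le hn ht hc
  have hn0 : 0 ≤ (n : ℝ) := n.cast_nonneg
  set s : ℝ := (n : ℝ) + 1 + t with hs
  have hs0 : 0 < s := by linarith
  refine ⟨B + K * 4 ^ (s + c) * 2 ^ c * 4 ^ (-s), by positivity, fun x hx r hr w hw => ?_⟩
  set A := B + K * 4 ^ (s + c) * 2 ^ c * 4 ^ (-s) with hA
  have hρ : 0 < 1 - ‖w‖ ^ 2 := by nlinarith [norm_nonneg w]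
  -- Near the tube, Forelli–Rudin over the whole ball supplies the k = 0 term. Far from it, the
  -- kernel is essentially constant on the tube.
  by_cases hd : ‖1 - herm w x‖ < 8 * r
  · refine le_trans ?_ (ENNReal.le_tsum 0)
    rw [Set.indicator_of_mem (show w ∈ carlesonTube x (8 * (2 ^ 0 * r)) from
      ⟨mem_unitBall.2 hw, by simpa using hd⟩), Pi.one_apply, pow_zero, mul_one, mul_one]
    have h1 := hker w hw
    simp only [norm_one_sub_herm_comm w] at h1
    calc _ ≤ ENNReal.ofReal ((1 - ‖w‖ ^ 2) ^ c) *
          ENNReal.ofReal (B * (1 - ‖w‖ ^ 2) ^ (-c)) := by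
          gcongr
          exact (setLIntegral_le_lintegral _ _).trans h1
      _ = ENNReal.ofReal B := by
          rw [← ENNReal.ofReal_mul (by positivity), mul_left_comm, ← Real.rpow_add hρ,
            add_neg_cancel, Real.rpow_zero, mul_one]
      _ ≤ _ := ENNReal.ofReal_le_ofReal (by
          rw [hA, le_add_iff_nonneg_right]; positivity)
  · push Not at hd
    set d := ‖1 - herm w x‖ with hd'
    have hd0 : 0 < d := by linarith
    obtain ⟨k, hk1, hk2⟩ := exists_nat_pow_near (x := d / (8 * r))
      (by rwa [one_le_div₀ (by positivity)]) one_lt_two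
    rw [le_div_iff₀ (by positivity)] at hk1
    rw [div_lt_iff₀ (by positivity)] at hk2
    -- The index is k + 1 because only the upper bound d < 2^(k+1) · 8r places w in a tube.
    refine le_trans ?_ (ENNReal.le_tsum (k + 1))
    rw [Set.indicator_of_mem (show w ∈ carlesonTube x (8 * (2 ^ (k + 1) * r)) from
      ⟨mem_unitBall.2 hw, by rw [← hd']; linarith⟩), Pi.one_apply, mul_one]
    calc _ ≤ ENNReal.ofReal ((2 * d) ^ c) * ∫⁻ z in carlesonTube x r,
          ENNReal.ofReal ((d / 4) ^ (-(s + c))) * ENNReal.ofReal ((1 - ‖z‖ ^ 2) ^ t)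
            ∂ballMeasure n := by
          gcongr ENNReal.ofReal ?_ * ?_
          · exact Real.rpow_le_rpow hρ.le (one_sub_norm_sq_le w x hw.le hx.le) hc.le
          · refine setLIntegral_mono' (measurableSet_carlesonTube x r) fun z hz => ?_
            have hz1 := mem_unitBall.1 hz.1
            -- This gives d ≤ 2D + 4r ≤ 2D + d/2, hence D ≥ d/4; the cutoff 8r serves this
            -- absorption.
            have hq := norm_one_sub_herm_quasi_triangle w z x hw.le hz1.le hx.le
            have hz2 := hz.2
            rw [← ENNReal.ofReal_mul (by positivity), mul_comm]
            refine ENNReal.ofReal_le_ofReal ?_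
            have : 0 ≤ (1 - ‖z‖ ^ 2) ^ t := Real.rpow_nonneg (by nlinarith [norm_nonneg z]) _
            gcongr ?_ * _
            refine Real.rpow_le_rpow_of_nonpos (by positivity) ?_ (by linarith)
            rw [norm_one_sub_herm_comm z w]
            linarith
      _ ≤ ENNReal.ofReal ((2 * d) ^ c) * (ENNReal.ofReal ((d / 4) ^ (-(s + c))) *
            ENNReal.ofReal (K * r ^ s)) := by
          rw [lintegral_const_mul _ (by fun_prop)]
          gcongr
          exact hvol x hx r hr
      _ = ENNReal.ofReal (K * 4 ^ (s + c) * 2 ^ c * (d / r) ^ (-s)) := by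
          rw [← ENNReal.ofReal_mul (by positivity), ← ENNReal.ofReal_mul (by positivity)]
          congr 1
          rw [Real.mul_rpow (by norm_num) hd0.le, Real.div_rpow hd0.le (by norm_num),
            Real.div_rpow hd0.le hr.le, Real.rpow_neg hr.le, Real.rpow_neg (by norm_num : (0:ℝ) ≤ 4),
            neg_add, Real.rpow_add hd0, Real.rpow_neg hd0.le c]
          have : d ^ c ≠ 0 := by positivity
          field_simp
      _ ≤ ENNReal.ofReal (K * 4 ^ (s + c) * 2 ^ c * (4 ^ (-s) * (2 ^ (-s)) ^ (k + 1))) := by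
          refine ENNReal.ofReal_le_ofReal ?_
          gcongr
          rw [← Real.rpow_natCast, ← Real.rpow_mul (by norm_num), mul_comm (-s),
            Real.rpow_mul (by norm_num), Real.rpow_natCast,
            ← Real.mul_rpow (by norm_num) (by positivity)]
          refine Real.rpow_le_rpow_of_nonpos (by positivity) ?_ (by linarith)
          rw [le_div_iff₀ hr, pow_succ]
          linarith
      _ ≤ _ := by
          refine ENNReal.ofReal_le_ofReal ?_
          rw [← mul_assoc]
          gcongr
          rw [hA, le_add_iff_nonneg_left]; positivity

/-! ### Cauchy–Schwarz and tubewise Carleson bounds. -/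

theorem sq_lintegral_le_of_sq_le_mul {α : Type*} [MeasurableSpace α] (μ : Measure α)
    {g u v : α → ℝ≥0∞} (hu : AEMeasurable u μ) (hv : AEMeasurable v μ)
    (h : ∀ᵐ x ∂μ, g x ^ 2 ≤ u x * v x) :
    (∫⁻ x, g x ∂μ) ^ 2 ≤ (∫⁻ x, u x ∂μ) * ∫⁻ x, v x ∂μ := by
  have h1 : ∫⁻ x, g x ∂μ ≤ ∫⁻ x, ((fun x => u x ^ (1 / 2 : ℝ)) * fun x => v x ^ (1 / 2 : ℝ)) x ∂μ := by
    refine lintegral_mono_ae ?_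
    filter_upwards [h] with x hx
    have := ENNReal.rpow_le_rpow hx (show (0 : ℝ) ≤ 1 / 2 by norm_num)
    rw [← ENNReal.rpow_natCast, ← ENNReal.rpow_mul, ENNReal.mul_rpow_of_nonneg _ _ (by norm_num)]
      at this
    simpa using this
  have h2 := h1.trans (ENNReal.lintegral_mul_le_Lp_mul_Lq μ Real.HolderConjugate.two_two
    (hu.pow_const _) (hv.pow_const _))
  have e : ∀ y : ℝ≥0∞, (y ^ (1 / 2 : ℝ)) ^ (2 : ℝ) = y := fun y => by
    rw [← ENNReal.rpow_mul]; norm_num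
  have e' : ∀ y : ℝ≥0∞, (y ^ (1 / 2 : ℝ)) ^ 2 = y := fun y => by
    rw [← ENNReal.rpow_natCast, ← ENNReal.rpow_mul]; norm_num
  simp only [e] at h2
  calc _ ≤ _ := pow_le_pow_left' h2 2
    _ = _ := by rw [mul_pow, e', e']

theorem isCarlesonMeasure_of_le {p : ℝ} {μ : Measure (𝔼 n)} {M : ℝ≥0∞} (hM : M ≠ ⊤)
    (h : ∀ x : 𝔼 n, ‖x‖ = 1 → ∀ r : ℝ, 0 < r →
      μ (carlesonTube x r) ≤ M * ENNReal.ofReal (r ^ ((n : ℝ) * p))) :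
    IsCarlesonMeasure p μ := by
  have : carlesonNorm p μ ≤ M ^ (1 / 2 : ℝ) := by
    refine iSup₂_le fun x hx => iSup₂_le fun r hr => ?_
    exact ENNReal.rpow_le_rpow (ENNReal.div_le_of_le_mul (h x (mem_unitSphere.1 hx) r hr))
      (by norm_num)
  exact this.trans_lt (ENNReal.rpow_lt_top_of_nonneg (by norm_num) hM)

theorem IsCarlesonMeasure.exists_le {p : ℝ} {μ : Measure (𝔼 n)} (h : IsCarlesonMeasure p μ) :
    ∃ M : ℝ≥0∞, M ≠ ⊤ ∧ ∀ x : 𝔼 n, ‖x‖ = 1 → ∀ r : ℝ, 0 < r →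
      μ (carlesonTube x r) ≤ M * ENNReal.ofReal (r ^ ((n : ℝ) * p)) := by
  refine ⟨carlesonNorm p μ ^ 2, ENNReal.pow_ne_top h.ne, fun x hx r hr => ?_⟩
  have h1 : (μ (carlesonTube x r) / ENNReal.ofReal (r ^ ((n : ℝ) * p))) ^ (1 / 2 : ℝ) ≤
      carlesonNorm p μ :=
    le_iSup₂_of_le x (mem_unitSphere.2 hx) (le_iSup₂_of_le r hr le_rfl)
  have h2 := pow_le_pow_left' h1 2
  rw [← ENNReal.rpow_natCast, ← ENNReal.rpow_mul] at h2
  norm_num at h2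
  have hpos : 0 < r ^ ((n : ℝ) * p) := by positivity
  rwa [ENNReal.div_le_iff_le_mul (Or.inl (by simpa using hpos)) (Or.inl ENNReal.ofReal_ne_top)]
    at h2

theorem measurable_herm_fst_snd :
    Measurable fun q : (𝔼 n) × (𝔼 n) => ‖1 - herm q.1 q.2‖ :=
  (continuous_const.sub continuous_herm).norm.measurable

theorem measurable_norm_one_sub_herm (z : 𝔼 n) : Measurable fun w => ‖1 - herm z w‖ :=
  (continuous_const.sub (continuous_herm.comp (Continuous.prodMk_right z))).norm.measurable

/-- A measure with `μ (Q_r) ≤ M r ^ (n p)` integrates dyadically decaying functions well. -/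
theorem lintegral_dyadic_le {μ : Measure (𝔼 n)} {M : ℝ≥0∞} {m s A : ℝ} {x : 𝔼 n}
    (hμ : ∀ r : ℝ, 0 < r → μ (carlesonTube x r) ≤ M * ENNReal.ofReal (r ^ m))
    (hms : m < s) (hA : 0 ≤ A) {r : ℝ} (hr : 0 < r) :
    ∫⁻ w, ∑' k : ℕ, ENNReal.ofReal (A * (2 ^ (-s)) ^ k) *
        (carlesonTube x (8 * (2 ^ k * r))).indicator 1 w ∂μ ≤
      M * ENNReal.ofReal (A * 8 ^ m * (1 - 2 ^ (m - s))⁻¹) * ENNReal.ofReal (r ^ m) := by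
  have hmeas : ∀ R : ℝ, Measurable ((carlesonTube x R).indicator (1 : (𝔼 n) → ℝ≥0∞)) := fun R =>
    measurable_one.indicator (measurableSet_carlesonTube x R)
  have hq : (2 : ℝ) ^ (m - s) < 1 := Real.rpow_lt_one_of_one_lt_of_neg one_lt_two (by linarith)
  have hq' : 0 < 1 - (2 : ℝ) ^ (m - s) := by linarith
  rw [lintegral_tsum fun k => ((hmeas _).const_mul _).aemeasurable]
  calc _ ≤ ∑' k : ℕ, M * ENNReal.ofReal (A * 8 ^ m * r ^ m * (2 ^ (m - s)) ^ k) := by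
        refine ENNReal.tsum_le_tsum fun k => ?_
        rw [lintegral_const_mul _ (hmeas _), lintegral_indicator_one (measurableSet_carlesonTube x _)]
        refine (mul_le_mul_right (hμ _ (by positivity)) _).trans (le_of_eq ?_)
        rw [mul_left_comm, ← ENNReal.ofReal_mul (by positivity)]
        congr 2
        rw [Real.mul_rpow (by norm_num) (by positivity), Real.mul_rpow (by positivity) hr.le,
          sub_eq_add_neg, Real.rpow_add two_pos, mul_pow, ← Real.rpow_natCast 2 k,
          ← Real.rpow_mul (by norm_num), mul_comm (k : ℝ), Real.rpow_mul (by norm_num),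
          Real.rpow_natCast]
        ring
    _ = M * ENNReal.ofReal (A * 8 ^ m * r ^ m * (1 - 2 ^ (m - s))⁻¹) := by
        rw [ENNReal.tsum_mul_left, tsum_ofReal_geometric (by positivity) (by positivity) hq]
    _ = _ := by
        rw [mul_assoc M, ← ENNReal.ofReal_mul (by positivity)]
        congr 2; ring

/-! ### The operator: absolute convergence and the Carleson bound. -/

theorem measurable_kernelT (a b : ℝ) (z : 𝔼 n) : Measurable (kernelT a b z) :=
  Measurable.div (by fun_prop) ((measurable_norm_one_sub_herm z).pow_const _)

theorem kernelT_sq_eq {a b t u : ℝ} {z w : 𝔼 n} (hz : ‖z‖ < 1) (hw : ‖w‖ < 1) :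
    kernelT a b z w ^ 2 = (1 - ‖w‖ ^ 2) ^ t * ‖1 - herm z w‖ ^ (-u) *
      ((1 - ‖w‖ ^ 2) ^ (2 * b - 2 - t) * ‖1 - herm z w‖ ^ (-(2 * (n + a + b) - u))) := by
  have hρ : 0 < 1 - ‖w‖ ^ 2 := by nlinarith [norm_nonneg w]
  have hD := norm_one_sub_herm_pos hz hw.le
  have e1 : ((1 - ‖w‖ ^ 2) ^ (b - 1)) ^ 2 = (1 - ‖w‖ ^ 2) ^ (t + (2 * b - 2 - t)) := by
    rw [← Real.rpow_mul_natCast hρ.le]; congr 1; push_cast; ring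
  have e2 : ((‖1 - herm z w‖ ^ ((n : ℝ) + a + b)) ^ 2)⁻¹ =
      ‖1 - herm z w‖ ^ (-u + -(2 * (n + a + b) - u)) := by
    rw [← Real.rpow_mul_natCast hD.le, ← Real.rpow_neg hD.le]; congr 1; push_cast; ring
  rw [mul_mul_mul_comm, ← Real.rpow_add hρ, ← Real.rpow_add hD, kernelT, div_pow, div_eq_mul_inv,
    e1, e2]

/-- Cauchy–Schwarz for `opT` with weights. -/
theorem sq_lintegral_kernelT_le (a b t u η : ℝ) {f : (𝔼 n) → ℂ} (hf : Measurable f) {z : 𝔼 n}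
    (hz : ‖z‖ < 1) :
    (∫⁻ w, ‖(kernelT a b z w : ℂ) * f w‖ₑ ∂ballMeasure n) ^ 2 ≤
      (∫⁻ w, ENNReal.ofReal ((1 - ‖w‖ ^ 2) ^ t * ‖1 - herm z w‖ ^ (-u)) ∂ballMeasure n) *
      ∫⁻ w, ENNReal.ofReal ((1 - ‖w‖ ^ 2) ^ (2 * b - 2 - t - η)) *
        ENNReal.ofReal (‖1 - herm z w‖ ^ (-(2 * (n + a + b) - u))) ∂weightedMeasure f η := by
  have hD := measurable_norm_one_sub_herm z
  have hdens : Measurable fun w => ENNReal.ofReal (‖f w‖ ^ 2 * (1 - ‖w‖ ^ 2) ^ η) := by fun_prop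
  have hv : Measurable fun w => ENNReal.ofReal ((1 - ‖w‖ ^ 2) ^ (2 * b - 2 - t - η)) *
        ENNReal.ofReal (‖1 - herm z w‖ ^ (-(2 * (n + a + b) - u))) := by fun_prop
  rw [weightedMeasure, lintegral_withDensity_eq_lintegral_mul _ hdens hv]
  refine sq_lintegral_le_of_sq_le_mul _ (by fun_prop) (hdens.mul hv).aemeasurable ?_
  filter_upwards [ae_ballMeasure] with w hw
  have hρ : 0 < 1 - ‖w‖ ^ 2 := by nlinarith [norm_nonneg w]
  rw [Pi.mul_apply, ← ENNReal.ofReal_mul (by positivity), ← ENNReal.ofReal_mul (by positivity),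
    ← ENNReal.ofReal_mul (by positivity), ← ofReal_norm,
    ← ENNReal.ofReal_pow (norm_nonneg _)]
  refine ENNReal.ofReal_le_ofReal (le_of_eq ?_)
  rw [norm_mul, mul_pow, Complex.norm_real, Real.norm_eq_abs, sq_abs,
    kernelT_sq_eq (t := t) (u := u) hz hw]
  have e : (1 - ‖w‖ ^ 2) ^ (2 * b - 2 - t) =
      (1 - ‖w‖ ^ 2) ^ η * (1 - ‖w‖ ^ 2) ^ (2 * b - 2 - t - η) := by
    rw [← Real.rpow_add hρ]; congr 1; ring
  rw [e]; ring

theorem ae_weightedMeasure (f : (𝔼 n) → ℂ) (η : ℝ) : ∀ᵐ w ∂weightedMeasure f η, ‖w‖ < 1 :=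
  (withDensity_absolutelyContinuous _ _).ae_le ae_ballMeasure

/-- A tube of radius 2 is the whole ball. Finiteness serves both absolute convergence and Tonelli.
-/
theorem weightedMeasure_univ_lt_top (hn : 1 ≤ n) {f : (𝔼 n) → ℂ} {η p : ℝ}
    (h : IsCarlesonMeasure p (weightedMeasure f η)) : weightedMeasure f η Set.univ < ⊤ := by
  obtain ⟨M, hM, hle⟩ := h.exists_le
  obtain ⟨x, hx, -⟩ := exists_norm_smul_eq hn 0
  have h1 : weightedMeasure f η Set.univ = weightedMeasure f η (carlesonTube x 2) := by
    refine measure_congr ?_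
    filter_upwards [ae_weightedMeasure f η] with w hw
    exact propext ⟨fun _ => ⟨mem_unitBall.2 hw, norm_one_sub_herm_le_two w x hw hx.le⟩,
      fun _ => trivial⟩
  rw [h1]
  exact (hle x hx 2 two_pos).trans_lt (ENNReal.mul_lt_top hM.lt_top ENNReal.ofReal_lt_top)

theorem integrable_kernelT_mul (hn : 1 ≤ n) {p η a b : ℝ} (hb : (1 + η) / 2 < b)
    {f : (𝔼 n) → ℂ} (hf : Measurable f) (hfC : IsCarlesonMeasure p (weightedMeasure f η))
    {z : 𝔼 n} (hz : ‖z‖ < 1) :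
    Integrable (fun w => (kernelT a b z w : ℂ) * f w) (ballMeasure n) := by
  have hm : Measurable fun w => (kernelT a b z w : ℂ) * f w :=
    (Complex.measurable_ofReal.comp (measurable_kernelT a b z)).mul hf
  refine ⟨hm.aestronglyMeasurable, ?_⟩
  have hμ := weightedMeasure_univ_lt_top hn hfC
  have ht : -1 < 2 * b - 2 - η := by linarith
  -- With t = 2b - 2 - η the weight disappears from the μ-integral; the final 1 is an arbitrary
  -- choice of c.
  set u : ℝ := (n : ℝ) + 1 + (2 * b - 2 - η) + 1 with hu
  set v : ℝ := 2 * (n + a + b) - u with hv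
  obtain ⟨C, hC, hker⟩ := exists_lintegral_kernel_le hn ht one_pos
  have h1 := sq_lintegral_kernelT_le a b (2 * b - 2 - η) u η hf hz
  have h2 : ∫⁻ w, ENNReal.ofReal ((1 - ‖w‖ ^ 2) ^ (2 * b - 2 - (2 * b - 2 - η) - η)) *
      ENNReal.ofReal (‖1 - herm z w‖ ^ (-v)) ∂weightedMeasure f η < ⊤ := by
    -- For fixed z, D lies between 1 - |z| and 2. The sign of v is unknown, so both endpoint powers
    -- are added.
    have h3 : ∫⁻ w, ENNReal.ofReal ((1 - ‖w‖ ^ 2) ^ (2 * b - 2 - (2 * b - 2 - η) - η)) *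
        ENNReal.ofReal (‖1 - herm z w‖ ^ (-v)) ∂weightedMeasure f η ≤
        ∫⁻ _, ENNReal.ofReal ((1 - ‖z‖) ^ (-v) + 2 ^ (-v)) ∂weightedMeasure f η := by
      refine lintegral_mono_ae ?_
      filter_upwards [ae_weightedMeasure f η] with w hw
      have hz0 : 0 < 1 - ‖z‖ := by linarith
      have hD := norm_one_sub_herm_pos hz hw.le
      rw [show 2 * b - 2 - (2 * b - 2 - η) - η = 0 by ring, Real.rpow_zero, ENNReal.ofReal_one,
        one_mul]
      refine ENNReal.ofReal_le_ofReal ?_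
      rcases le_total (-v) 0 with h | h
      · have := Real.rpow_le_rpow_of_nonpos hz0 (one_sub_norm_le z w hw.le) h
        have h' : (0 : ℝ) ≤ 2 ^ (-v) := by positivity
        linarith
      · have := Real.rpow_le_rpow hD.le (norm_one_sub_herm_le_two z w hz hw.le).le h
        have h' : 0 ≤ (1 - ‖z‖) ^ (-v) := by positivity
        linarith
    refine h3.trans_lt ?_
    rw [lintegral_const]
    exact ENNReal.mul_lt_top ENNReal.ofReal_lt_top hμ
  have h4 := h1.trans_lt (ENNReal.mul_lt_top ((hker z hz).trans_lt ENNReal.ofReal_lt_top) h2)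
  rw [HasFiniteIntegral]
  by_contra hcon
  rw [not_lt, top_le_iff] at hcon
  rw [hcon] at h4
  simp at h4

theorem enorm_opT_sq_le (a b t u η : ℝ) {f : (𝔼 n) → ℂ} (hf : Measurable f) {z : 𝔼 n}
    (hz : ‖z‖ < 1) :
    ENNReal.ofReal (‖opT a b f z‖ ^ 2) ≤
      (∫⁻ w, ENNReal.ofReal ((1 - ‖w‖ ^ 2) ^ t * ‖1 - herm z w‖ ^ (-u)) ∂ballMeasure n) *
      ∫⁻ w, ENNReal.ofReal ((1 - ‖w‖ ^ 2) ^ (2 * b - 2 - t - η)) *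
        ENNReal.ofReal (‖1 - herm z w‖ ^ (-(2 * (n + a + b) - u))) ∂weightedMeasure f η := by
  refine le_trans ?_ (sq_lintegral_kernelT_le a b t u η hf hz)
  rw [ENNReal.ofReal_pow (norm_nonneg _), ofReal_norm]
  exact pow_le_pow_left' (enorm_integral_le_lintegral_enorm _) 2

theorem isCarlesonMeasure_opT (hn : 1 ≤ n) {p η a b : ℝ}
    (ha : -((1 + η) / 2) < a) (ha' : -((1 + η + (n : ℝ) * (1 - p)) / 2) < a)
    (hb : (1 + η) / 2 < b) {f : (𝔼 n) → ℂ} (hf : Measurable f)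
    (hfC : IsCarlesonMeasure p (weightedMeasure f η)) :
    IsCarlesonMeasure p (weightedMeasure (opT a b f) (2 * a + η)) := by
  -- Strictness of t < 2b - 2 - η leaves a positive power of 1 - |w|² for the tube estimate. The two
  -- bounds on c give 2a + η - c > -1 and np < s.
  obtain ⟨t, ht, htb⟩ := exists_between (show -1 < 2 * b - 2 - η by linarith)
  obtain ⟨c, hc, hcm⟩ := exists_between
    (show (0 : ℝ) < min (1 + 2 * a + η) (1 + 2 * a + η + n * (1 - p)) from
      lt_min (by linarith) (by linarith))
  have hc1 := hcm.trans_le (min_le_left _ _)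
  have hc2 := hcm.trans_le (min_le_right _ _)
  have ht' : -1 < 2 * a + η - c := by linarith
  have hc' : 0 < 2 * b - 2 - t - η := by linarith
  obtain ⟨B, hB, hker⟩ := exists_lintegral_kernel_le hn ht hc
  obtain ⟨A, hA, htube⟩ := exists_lintegral_kernel_tube_le hn ht' hc'
  obtain ⟨M, hM, hle⟩ := hfC.exists_le
  set μ := weightedMeasure f η with hμ
  have : IsFiniteMeasure μ := ⟨weightedMeasure_univ_lt_top hn hfC⟩
  set s : ℝ := (n : ℝ) + 1 + (2 * a + η - c) with hs
  have hms : (n : ℝ) * p < s := by linarith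
  set u : ℝ := (n : ℝ) + 1 + t + c with hu
  have hv : 2 * ((n : ℝ) + a + b) - u = s + (2 * b - 2 - t - η) := by rw [hu, hs]; ring
  have hD := measurable_herm_fst_snd (n := n)
  have hD' := measurable_norm_one_sub_herm (n := n)
  refine isCarlesonMeasure_of_le (M := ENNReal.ofReal B *
    (M * ENNReal.ofReal (A * 8 ^ ((n : ℝ) * p) * (1 - 2 ^ ((n : ℝ) * p - s))⁻¹)))
    (ENNReal.mul_ne_top ENNReal.ofReal_ne_top (ENNReal.mul_ne_top hM ENNReal.ofReal_ne_top))
    fun x hx r hr => ?_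
  rw [weightedMeasure, withDensity_apply _ (measurableSet_carlesonTube x r), mul_assoc]
  calc _ ≤ ∫⁻ z in carlesonTube x r, ENNReal.ofReal B *
        ∫⁻ w, ENNReal.ofReal ((1 - ‖w‖ ^ 2) ^ (2 * b - 2 - t - η)) *
          ENNReal.ofReal ((1 - ‖z‖ ^ 2) ^ (2 * a + η - c) *
            ‖1 - herm z w‖ ^ (-(s + (2 * b - 2 - t - η)))) ∂μ ∂ballMeasure n := by
        refine setLIntegral_mono' (measurableSet_carlesonTube x r) fun z hz => ?_
        have hz1 := mem_unitBall.1 hz.1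
        have hρ : 0 < 1 - ‖z‖ ^ 2 := by nlinarith [norm_nonneg z]
        have h1 := enorm_opT_sq_le a b t u η hf hz1
        rw [hv] at h1
        calc _ = ENNReal.ofReal (‖opT a b f z‖ ^ 2) *
              ENNReal.ofReal ((1 - ‖z‖ ^ 2) ^ (2 * a + η)) := ENNReal.ofReal_mul (by positivity)
          _ ≤ (ENNReal.ofReal (B * (1 - ‖z‖ ^ 2) ^ (-c)) *
              ∫⁻ w, ENNReal.ofReal ((1 - ‖w‖ ^ 2) ^ (2 * b - 2 - t - η)) *
              ENNReal.ofReal (‖1 - herm z w‖ ^ (-(s + (2 * b - 2 - t - η)))) ∂μ) *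
              ENNReal.ofReal ((1 - ‖z‖ ^ 2) ^ (2 * a + η)) := by
            gcongr
            refine h1.trans ?_
            gcongr
            exact hker z hz1
          _ = ENNReal.ofReal B * (ENNReal.ofReal ((1 - ‖z‖ ^ 2) ^ (2 * a + η - c)) *
              ∫⁻ w, ENNReal.ofReal ((1 - ‖w‖ ^ 2) ^ (2 * b - 2 - t - η)) *
              ENNReal.ofReal (‖1 - herm z w‖ ^ (-(s + (2 * b - 2 - t - η)))) ∂μ) := by
            have e : (1 - ‖z‖ ^ 2) ^ (2 * a + η - c) =
                (1 - ‖z‖ ^ 2) ^ (-c) * (1 - ‖z‖ ^ 2) ^ (2 * a + η) := by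
              rw [← Real.rpow_add hρ]; congr 1; ring
            rw [e, ENNReal.ofReal_mul hB.le, ENNReal.ofReal_mul (by positivity)]
            ring
          _ = _ := by
            rw [← lintegral_const_mul _ (by have := hD' z; fun_prop)]
            congr 2 with w
            rw [ENNReal.ofReal_mul (by positivity)]
            ring
    -- Tonelli: the z-integral over the tube is now innermost, for fixed w.
    _ = ENNReal.ofReal B * ∫⁻ w, ∫⁻ z in carlesonTube x r,
          ENNReal.ofReal ((1 - ‖w‖ ^ 2) ^ (2 * b - 2 - t - η)) *
          ENNReal.ofReal ((1 - ‖z‖ ^ 2) ^ (2 * a + η - c) *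
            ‖1 - herm z w‖ ^ (-(s + (2 * b - 2 - t - η)))) ∂ballMeasure n ∂μ := by
        have hm : Measurable fun q : (𝔼 n) × (𝔼 n) =>
            ENNReal.ofReal ((1 - ‖q.2‖ ^ 2) ^ (2 * b - 2 - t - η)) *
            ENNReal.ofReal ((1 - ‖q.1‖ ^ 2) ^ (2 * a + η - c) *
            ‖1 - herm q.1 q.2‖ ^ (-(s + (2 * b - 2 - t - η)))) := by fun_prop
        rw [lintegral_const_mul _ hm.lintegral_prod_right', lintegral_lintegral_swap hm.aemeasurable]
    _ ≤ ENNReal.ofReal B * ∫⁻ w, ∑' k : ℕ, ENNReal.ofReal (A * (2 ^ (-s)) ^ k) *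
          (carlesonTube x (8 * (2 ^ k * r))).indicator 1 w ∂μ := by
        refine mul_le_mul_right (lintegral_mono_ae ?_) _
        filter_upwards [ae_weightedMeasure f η] with w hw
        have hm : Measurable fun z => ‖1 - herm z w‖ := by
          simpa only [norm_one_sub_herm_comm w] using hD' w
        rw [lintegral_const_mul _ (by fun_prop)]
        exact htube x hx r hr w hw
    _ ≤ _ := mul_le_mul_right (lintegral_dyadic_le (hle x hx) hms hA.le hr) _

/-! ### Passage to a Borel representative of f. -/

theorem weightedMeasure_congr {f g : (𝔼 n) → ℂ} (h : f =ᵐ[ballMeasure n] g) (η : ℝ) :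
    weightedMeasure f η = weightedMeasure g η := by
  refine withDensity_congr_ae ?_
  filter_upwards [h] with w hw
  rw [hw]

theorem opT_congr {f g : (𝔼 n) → ℂ} (h : f =ᵐ[ballMeasure n] g) (a b : ℝ) :
    opT a b f = opT a b g := by
  funext z
  refine integral_congr_ae ?_
  filter_upwards [h] with w hw
  rw [hw]

end ModifiedCarleson

end

theorem theoreml23 (n : ℕ) (hn : 1 ≤ n) (p η a b : ℝ)
    (hp : p ∈ Set.Ioo (0 : ℝ) (((n : ℝ) + 1) / n))
    (hη : η ∈ Set.Ioo (0 : ℝ) (((n : ℝ) + 1) / n))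
    (ha : max (-((1 + η) / 2)) (-((1 + η + (n : ℝ) * (1 - p)) / 2)) < a)
    (hb : (1 + η) / 2 < b)
    (f : EuclideanSpace ℂ (Fin n) → ℂ)
    (hf : AEMeasurable f (ModifiedCarleson.ballMeasure n))
    (hfC : ModifiedCarleson.IsCarlesonMeasure p (ModifiedCarleson.weightedMeasure f η)) :
    (∀ z ∈ ModifiedCarleson.unitBall n,
      MeasureTheory.Integrable
        (fun w => (ModifiedCarleson.kernelT a b z w : ℂ) * f w)
        (ModifiedCarleson.ballMeasure n)) ∧
    ModifiedCarleson.IsCarlesonMeasure p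
      (ModifiedCarleson.weightedMeasure (ModifiedCarleson.opT a b f) (2 * a + η)) := by
  obtain ⟨g, hg, hfg⟩ := hf
  rw [ModifiedCarleson.weightedMeasure_congr hfg] at hfC
  refine ⟨fun z hz => ?_, ?_⟩
  · refine (ModifiedCarleson.integrable_kernelT_mul (a := a) hn hb hg hfC
      (ModifiedCarleson.mem_unitBall.1 hz)).congr ?_
    filter_upwards [hfg] with w hw
    rw [hw]
  · rw [ModifiedCarleson.opT_congr hfg]
    exact ModifiedCarleson.isCarlesonMeasure_opT hn ((le_max_left _ _).trans_lt ha)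
      ((le_max_right _ _).trans_lt ha) hb hg hfC
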